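/- Let $t\ge 1$ be an integer and let $G$ be a finite simple graph on $n\ge 1$ vertices containing no copy of the path $P_t$ on $t$ vertices as a (not necessarily induced) subgraph. Let $\lambda_n(G)$ denote the least eigenvalue of the adjacency matrix of $G$, and let $K_{a,b}$ be the complete bipartite graph with parts of sizes $a$ and $b$ ($K_{0,b}$ being the graph on $b$ vertices without edges). (i) If $n<t$, then $\lambda_n(G)\ge -\sqrt{\lfloor n/2\rfloor\lceil n/2\rceil}$, and equality holds if and only if $G\cong K_{\lfloor n/2\rfloor,\lceil n/2\rceil}$. (ii) If $n\ge t$ and $t\ne 3$, then, with $k=\lfloor (t-2)/2\rfloor$, $\lambda_n(G)\ge -\sqrt{k(n-k)}$, and equality holds if and only if either $G\cong K_{k,n-k}$, or $n=t=5$ and $G\cong K_{2,2}\cup K_1$ (disjoint union). -/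

import Mathlib

/-- The least eigenvalue of the (real) adjacency matrix of a finite graph. -/
noncomputable def SimpleGraph.leastEigenvalue {V : Type*} [Fintype V] [DecidableEq V]
    (G : SimpleGraph V) [DecidableRel G.Adj] : ℝ :=
  sInf (spectrum ℝ (G.adjMatrix ℝ))

/-- On a nonempty vertex set the infimum is attained: it is the smallest eigenvalue. -/
theorem SimpleGraph.isLeast_leastEigenvalue {V : Type*} [Fintype V] [DecidableEq V] [Nonempty V]
    (G : SimpleGraph V) [DecidableRel G.Adj] :
    IsLeast (spectrum ℝ (G.adjMatrix ℝ)) G.leastEigenvalue := by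
  have hA : (G.adjMatrix ℝ).IsHermitian := by
    rw [Matrix.IsHermitian, Matrix.conjTranspose_eq_transpose_of_trivial]
    exact G.transpose_adjMatrix
  have hs := hA.spectrum_real_eq_range_eigenvalues
  have hfin : (spectrum ℝ (G.adjMatrix ℝ)).Finite := hs ▸ Set.finite_range _
  have hne : (spectrum ℝ (G.adjMatrix ℝ)).Nonempty := hs ▸ Set.range_nonempty _
  exact ⟨hne.csInf_mem hfin, fun _ hx => csInf_le hfin.bddBelow hx⟩

/-!
Split the vertices by the signs of a vector `x`, with sides `A` and `B`. Edges inside a side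
contribute nonnegatively to the Rayleigh quotient of `x`, and the edges across contribute at least
`-‖M‖`, where `M` is the biadjacency matrix between `A` and `B`. Hence the least eigenvalue is at
least `-√c` as soon as `‖M‖² ≤ c` for every bipartition, for instance because `c` bounds the number
of edges of every cut.

The number of vertices is written as `k + m`, and the bound wanted is `c = k * m`. For `t > n` the
trivial bound `#A * #B` on the size of a cut suffices. For `P_t`-free graphs a vertex with at most
`k` neighbours across is deleted: this lowers `m` by one and decreases the Frobenius norm, or the
operator norm, of `M` by at most `√k` in the sense of squares. Once no such vertex exists, every
vertex has at least `k + 1` neighbours across, and a greedy path shows that the bipartite graph is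
`(k + 1)`-regular, so `‖M‖ ≤ k + 1`, which is strictly smaller than `√(k * m)`.

If equality holds, the bound on `‖M‖` comes from the number of edges, and the equality case of
Cauchy-Schwarz, applied to both `x` and `-x` because the zeros of `x` may lie on either side, shows
that the positive and the negative vertices of `x` form a complete bipartite component with `k * m`
edges. Its smaller part has `k` vertices, except that `K_{2,2}` can occur for `t = 5`.
-/

namespace PathFree

open Finset SimpleGraph Matrix

section CrossDegree

variable {V : Type*} {G : SimpleGraph V} [DecidableRel G.Adj] {A B C : Finset V} {u v : V}

/-- The number of neighbours of `u` in `B`. -/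
def degreeIn (G : SimpleGraph V) [DecidableRel G.Adj] (B : Finset V) (u : V) : ℕ :=
  #{v ∈ B | G.Adj u v}

theorem degreeIn_eq_card (h : ∀ v ∈ B, G.Adj u v) : degreeIn G B u = #B :=
  congrArg card (filter_true_of_mem h)

theorem exists_adj_of_card_lt_degreeIn (h : #C < degreeIn G B u) :
    ∃ v ∈ B, v ∉ C ∧ G.Adj u v := by
  obtain ⟨v, hv, hvC⟩ := exists_mem_notMem_of_card_lt_card h
  rw [mem_filter] at hv
  exact ⟨v, hv.1, hvC, hv.2⟩

theorem degreeIn_le_degreeIn_erase_add_one [DecidableEq V] :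
    degreeIn G B u ≤ degreeIn G (B.erase v) u + 1 := by
  rw [degreeIn, degreeIn, filter_erase]
  exact tsub_le_iff_right.1 pred_card_le_card_erase

theorem sum_interedges {M : Type*} [AddCommMonoid M] (f : V → V → M) :
    ∑ p ∈ G.interedges A B, f p.1 p.2 = ∑ u ∈ A, ∑ v ∈ B with G.Adj u v, f u v := by
  rw [interedges_def, sum_filter, sum_product]
  simp only [sum_filter]

theorem sum_interedges_comm {M : Type*} [AddCommMonoid M] (f : V → V → M) :
    ∑ p ∈ G.interedges A B, f p.1 p.2 = ∑ p ∈ G.interedges B A, f p.2 p.1 := by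
  rw [interedges_def, interedges_def, sum_filter, sum_filter, sum_product, sum_product_right]
  simp only [G.adj_comm]

theorem card_interedges_eq_sum_degreeIn : #(G.interedges A B) = ∑ u ∈ A, degreeIn G B u := by
  simpa only [degreeIn, card_eq_sum_ones] using
    sum_interedges (G := G) (A := A) (B := B) fun _ _ ↦ 1

theorem card_interedges_comm : #(G.interedges A B) = #(G.interedges B A) := by
  simpa only [card_eq_sum_ones] using
    sum_interedges_comm (G := G) (A := A) (B := B) fun _ _ ↦ 1

theorem isCompleteBetween_of_card_mul_card_le (h : #A * #B ≤ #(G.interedges A B)) :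
    G.IsCompleteBetween A B := by
  have heq : G.interedges A B = A ×ˢ B :=
    eq_of_subset_of_card_le (filter_subset _ _) (by rwa [card_product])
  intro u hu v hv
  have huv : (u, v) ∈ G.interedges A B := heq ▸ mk_mem_product hu hv
  exact ((mk_mem_interedges_iff G).1 huv).2.2

end CrossDegree

section LongPaths

variable {V : Type*} {G : SimpleGraph V} {u v : V} {s t : ℕ}

theorem pathGraph_isContained_pathGraph (hst : s ≤ t) : pathGraph s ⊑ pathGraph t := by
  refine ⟨⟨⟨Fin.castLE hst, fun {i j} hij ↦ ?_⟩, Fin.castLE_injective hst⟩⟩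
  simpa only [pathGraph_adj, Fin.val_castLE] using hij

theorem free_pathGraph_mono (hst : s ≤ t) (h : (pathGraph s).Free G) : (pathGraph t).Free G :=
  fun ht ↦ h ((pathGraph_isContained_pathGraph hst).trans ht)

theorem not_adj_of_free_pathGraph_two (h : (pathGraph 2).Free G) : ¬ G.Adj u v :=
  fun huv ↦ h (Walk.IsPath.of_adj huv).isContained_pathGraph

variable [DecidableRel G.Adj] {A B : Finset V} {d k : ℕ}

/-- In the bipartite graph that `G` induces between the disjoint sets `A` and `B`, every vertex has
degree at least `d`. -/
structure HasMinCrossDegree (G : SimpleGraph V) [DecidableRel G.Adj] (d : ℕ)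
    (A B : Finset V) : Prop where
  disjoint : Disjoint A B
  left : ∀ u ∈ A, d ≤ degreeIn G B u
  right : ∀ v ∈ B, d ≤ degreeIn G A v

namespace HasMinCrossDegree

theorem symm (h : HasMinCrossDegree G d A B) : HasMinCrossDegree G d B A :=
  ⟨h.disjoint.symm, h.right, h.left⟩

theorem erase [DecidableEq V] (h : HasMinCrossDegree G (d + 1) A B) (u v : V) :
    HasMinCrossDegree G d (A.erase u) (B.erase v) where
  disjoint := h.disjoint.mono (erase_subset _ _) (erase_subset _ _)
  left w hw := Nat.le_of_add_le_add_right <|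
    (h.left w (mem_of_mem_erase hw)).trans degreeIn_le_degreeIn_erase_add_one
  right w hw := Nat.le_of_add_le_add_right <|
    (h.right w (mem_of_mem_erase hw)).trans degreeIn_le_degreeIn_erase_add_one

theorem of_isCompleteBetween (h : G.IsCompleteBetween A B) (hA : d ≤ #A) (hB : d ≤ #B) :
    HasMinCrossDegree G d A B where
  disjoint := disjoint_coe.1 h.disjoint
  left _ hu := hB.trans_eq (degreeIn_eq_card fun _ hv ↦ h hu hv).symm
  right _ hv := hA.trans_eq (degreeIn_eq_card fun _ hu ↦ (h hu hv).symm).symm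

theorem exists_isPath (h : HasMinCrossDegree G (k + 1) A B) (hu : u ∈ A) :
    ∃ C ⊆ B, #C ≤ k + 1 ∧ ∃ v, ∃ p : G.Walk u v,
      p.IsPath ∧ p.length = 2 * k + 1 ∧ ∀ w ∈ p.support, w ∈ A ∨ w ∈ C := by
  classical
  induction k generalizing A B u with
  | zero =>
    obtain ⟨v, hvB, -, huv⟩ := exists_adj_of_card_lt_degreeIn (C := ∅) (h.left u hu)
    refine ⟨{v}, singleton_subset_iff.2 hvB, (card_singleton v).le, v, huv.toWalk,
      Walk.IsPath.of_adj huv, rfl, ?_⟩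
    simp [hu]
  | succ k ih =>
    obtain ⟨v, hvB, -, huv⟩ := exists_adj_of_card_lt_degreeIn (C := ∅)
      ((Nat.succ_pos _).trans_le (h.left u hu))
    obtain ⟨w, hwA, hwu, hvw⟩ := exists_adj_of_card_lt_degreeIn (C := {u})
      ((Nat.lt_add_of_pos_left k.succ_pos).trans_le (h.right v hvB))
    rw [mem_singleton] at hwu
    obtain ⟨C, hCB, hCk, x, p, hp, hlen, hsupp⟩ := ih (h.erase u v) (mem_erase.2 ⟨hwu, hwA⟩)
    have hvA : v ∉ A := disjoint_right.1 h.disjoint hvB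
    have huB : u ∉ B := disjoint_left.1 h.disjoint hu
    have hup : u ∉ p.support := fun hmem ↦ (hsupp u hmem).elim (notMem_erase u A)
      fun huC ↦ huB (mem_of_mem_erase (hCB huC))
    have hvp : v ∉ p.support := fun hmem ↦ (hsupp v hmem).elim
      (fun hvA' ↦ hvA (mem_of_mem_erase hvA')) fun hvC ↦ notMem_erase v B (hCB hvC)
    refine ⟨insert v C, insert_subset hvB (hCB.trans (erase_subset _ _)),
      (card_insert_le v C).trans (Nat.succ_le_succ hCk), x, .cons huv (.cons hvw p), ?_, ?_, ?_⟩
    · simp [Walk.cons_isPath_iff, hp, hup, hvp, huv.ne]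
    · simp only [Walk.length_cons, hlen]; ring
    · simp only [Walk.support_cons, List.mem_cons, mem_insert]
      rintro y (rfl | rfl | hy)
      · exact .inl hu
      · exact .inr (.inl rfl)
      · exact (hsupp y hy).imp mem_of_mem_erase .inr

theorem pathGraph_even_isContained (h : HasMinCrossDegree G (k + 1) A B) (hu : u ∈ A) :
    pathGraph (2 * k + 2) ⊑ G := by
  obtain ⟨-, -, -, v, p, hp, hlen, -⟩ := h.exists_isPath hu
  have h' := hp.isContained_pathGraph
  rwa [hlen] at h'

theorem pathGraph_odd_isContained_of_adj (h : HasMinCrossDegree G (k + 1) A B) (hu : u ∈ A)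
    (hv : v ∉ A ∧ v ∉ B) (hvu : G.Adj v u) : pathGraph (2 * k + 3) ⊑ G := by
  obtain ⟨C, hCB, -, x, p, hp, hlen, hsupp⟩ := h.exists_isPath hu
  have hvp : v ∉ p.support := fun hmem ↦ (hsupp v hmem).elim hv.1 fun hvC ↦ hv.2 (hCB hvC)
  have h' := (hp.cons hvp (h := hvu)).isContained_pathGraph
  rwa [Walk.length_cons, hlen] at h'

theorem pathGraph_odd_isContained_of_lt_degreeIn (h : HasMinCrossDegree G (k + 1) A B)
    (hu : u ∈ A) (hdeg : k + 1 < degreeIn G B u) : pathGraph (2 * k + 3) ⊑ G := by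
  obtain ⟨C, -, hCk, x, p, hp, hlen, hsupp⟩ := h.exists_isPath hu
  obtain ⟨v, hvB, hvC, huv⟩ := exists_adj_of_card_lt_degreeIn (hCk.trans_lt hdeg)
  have hvp : v ∉ p.support := fun hmem ↦
    (hsupp v hmem).elim (disjoint_right.1 h.disjoint hvB) hvC
  have h' := (hp.cons hvp (h := huv.symm)).isContained_pathGraph
  rwa [Walk.length_cons, hlen] at h'

end HasMinCrossDegree

end LongPaths

section CrossForm

variable {V : Type*} {G : SimpleGraph V} [DecidableRel G.Adj] {A B : Finset V} {u : V}
  {a b : V → ℝ} {c c' : ℝ} {d e m : ℕ}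

/-- The value `aᵀ M b` of the bilinear form of the biadjacency matrix `M` of `G` between `A` and
`B`. -/
def crossForm (G : SimpleGraph V) [DecidableRel G.Adj] (A B : Finset V) (a b : V → ℝ) : ℝ :=
  ∑ p ∈ G.interedges A B, a p.1 * b p.2

/-- The operator norm of the biadjacency matrix of `G` between `A` and `B` is at most `√c`. -/
def CrossBound (G : SimpleGraph V) [DecidableRel G.Adj] (A B : Finset V) (c : ℝ) : Prop :=
  ∀ a b : V → ℝ, crossForm G A B a b ^ 2 ≤ c * ((∑ u ∈ A, a u ^ 2) * ∑ v ∈ B, b v ^ 2)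

theorem crossForm_comm : crossForm G A B a b = crossForm G B A b a := by
  simpa only [crossForm, mul_comm] using sum_interedges_comm fun u v ↦ a u * b v

theorem crossForm_self_nonneg (h : ∀ u ∈ A, ∀ v ∈ A, 0 ≤ a u * a v) :
    0 ≤ crossForm G A A a a :=
  sum_nonneg fun p hp ↦
    let hp' := (mk_mem_interedges_iff G).1 hp
    h p.1 hp'.1 p.2 hp'.2.1

theorem crossForm_eq_add_crossForm_erase [DecidableEq V] (hu : u ∈ A) :
    crossForm G A B a b = (a u * ∑ v ∈ B with G.Adj u v, b v) + crossForm G (A.erase u) B a b := by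
  simp only [crossForm, sum_interedges fun u v ↦ a u * b v, ← mul_sum]
  exact (add_sum_erase A _ hu).symm

namespace CrossBound

theorem symm (h : CrossBound G A B c) : CrossBound G B A c := fun a b ↦ by
  rw [crossForm_comm, mul_comm (∑ u ∈ B, _)]
  exact h b a

theorem mono (hc : c ≤ c') (h : CrossBound G A B c) : CrossBound G A B c' := fun a b ↦
  (h a b).trans (by gcongr)

end CrossBound

theorem crossBound_card_interedges : CrossBound G A B #(G.interedges A B) := fun a b ↦
  calc crossForm G A B a b ^ 2
    _ ≤ #(G.interedges A B) * ∑ p ∈ G.interedges A B, (a p.1 * b p.2) ^ 2 :=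
      sq_sum_le_card_mul_sum_sq
    _ ≤ #(G.interedges A B) * ∑ p ∈ A ×ˢ B, (a p.1 * b p.2) ^ 2 := by
      gcongr
      exact filter_subset _ _
    _ = #(G.interedges A B) * ((∑ u ∈ A, a u ^ 2) * ∑ v ∈ B, b v ^ 2) := by
      simp only [mul_pow, sum_product, sum_mul_sum]

theorem sum_interedges_sq_le (h : ∀ u ∈ A, degreeIn G B u ≤ d) :
    ∑ p ∈ G.interedges A B, a p.1 ^ 2 ≤ d * ∑ u ∈ A, a u ^ 2 := by
  rw [sum_interedges fun u _ ↦ a u ^ 2, mul_sum]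
  refine sum_le_sum fun u hu ↦ ?_
  rw [sum_const, nsmul_eq_mul]
  gcongr
  exact h u hu

theorem crossBound_of_degreeIn_le (hA : ∀ u ∈ A, degreeIn G B u ≤ d)
    (hB : ∀ v ∈ B, degreeIn G A v ≤ e) : CrossBound G A B (d * e) := fun a b ↦
  calc crossForm G A B a b ^ 2
    _ ≤ (∑ p ∈ G.interedges A B, a p.1 ^ 2) * ∑ p ∈ G.interedges A B, b p.2 ^ 2 :=
      sum_mul_sq_le_sq_mul_sq _ _ _
    _ = (∑ p ∈ G.interedges A B, a p.1 ^ 2) * ∑ p ∈ G.interedges B A, b p.1 ^ 2 := by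
      rw [sum_interedges_comm fun _ v ↦ b v ^ 2]
    _ ≤ (d * ∑ u ∈ A, a u ^ 2) * (e * ∑ v ∈ B, b v ^ 2) := by
      gcongr
      exacts [sum_interedges_sq_le hA, sum_interedges_sq_le hB]
    _ = d * e * ((∑ u ∈ A, a u ^ 2) * ∑ v ∈ B, b v ^ 2) := by ring

theorem add_sq_le_add_mul_add {p q r s x y : ℝ} (hp : 0 ≤ p) (hq : 0 ≤ q) (hr : 0 ≤ r)
    (hs : 0 ≤ s) (hx : x ^ 2 ≤ p * q) (hy : y ^ 2 ≤ r * s) :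
    (x + y) ^ 2 ≤ (p + r) * (q + s) := by
  simpa [Fin.sum_univ_two, Fin.forall_fin_two, hp, hq, hr, hs, hx, hy] using
    sum_sq_le_sum_mul_sum_of_sq_le_mul univ (r := ![x, y]) (f := ![p, r]) (g := ![q, s])

theorem CrossBound.of_erase [DecidableEq V] (h : CrossBound G (A.erase u) B c) (hu : u ∈ A)
    (hc : 0 ≤ c) (hd : degreeIn G B u ≤ d) : CrossBound G A B (c + d) := fun a b ↦ by
  set S : ℝ := ∑ v ∈ B, b v ^ 2
  have : 0 ≤ S := sum_nonneg fun v _ ↦ sq_nonneg (b v)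
  have hrow : (a u * ∑ v ∈ B with G.Adj u v, b v) ^ 2 ≤ a u ^ 2 * (d * S) :=
    calc (a u * ∑ v ∈ B with G.Adj u v, b v) ^ 2
      _ ≤ a u ^ 2 * (degreeIn G B u * ∑ v ∈ B with G.Adj u v, b v ^ 2) := by
        rw [mul_pow]
        gcongr
        exact sq_sum_le_card_mul_sum_sq
      _ ≤ a u ^ 2 * (d * S) := by
        gcongr
        exact sum_le_sum_of_subset_of_nonneg (filter_subset _ _) fun v _ _ ↦ sq_nonneg (b v)
  have hrest : crossForm G (A.erase u) B a b ^ 2 ≤ (∑ w ∈ A.erase u, a w ^ 2) * (c * S) :=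
    (h a b).trans_eq (by ring)
  calc crossForm G A B a b ^ 2
    _ ≤ (a u ^ 2 + ∑ w ∈ A.erase u, a w ^ 2) * (d * S + c * S) := by
      rw [crossForm_eq_add_crossForm_erase hu]
      exact add_sq_le_add_mul_add (sq_nonneg _) (by positivity)
        (sum_nonneg fun w _ ↦ sq_nonneg (a w)) (by positivity) hrow hrest
    _ = (c + d) * ((∑ w ∈ A, a w ^ 2) * S) := by
      rw [add_sum_erase A (fun w ↦ a w ^ 2) hu]
      ring

/-- Either there are at most `m` edges between `A` and `B`, which bounds the norm of the biadjacency
matrix by `√m`, or that norm is less than `√m` for another reason. Only the first case allows the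
norm to be equal to `√m`. -/
def CrossDichotomy (G : SimpleGraph V) [DecidableRel G.Adj] (A B : Finset V) (m : ℕ) : Prop :=
  #(G.interedges A B) ≤ m ∨ ∃ c : ℝ, 0 ≤ c ∧ c < m ∧ CrossBound G A B c

namespace CrossDichotomy

theorem symm (h : CrossDichotomy G A B m) : CrossDichotomy G B A m :=
  h.imp card_interedges_comm.symm.trans_le fun ⟨c, hc, hcm, h⟩ ↦ ⟨c, hc, hcm, h.symm⟩

theorem crossBound (h : CrossDichotomy G A B m) : CrossBound G A B m :=
  h.elim (fun hm ↦ crossBound_card_interedges.mono (Nat.cast_le.2 hm))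
    fun ⟨_, _, hcm, h⟩ ↦ h.mono hcm.le

theorem of_erase [DecidableEq V] (h : CrossDichotomy G (A.erase u) B m) (hu : u ∈ A)
    (hd : degreeIn G B u ≤ d) : CrossDichotomy G A B (m + d) := by
  refine h.imp (fun hm ↦ ?_) fun ⟨c, hc, hcm, h⟩ ↦ ⟨c + d, by positivity, ?_, h.of_erase hu hc hd⟩
  · rw [card_interedges_eq_sum_degreeIn] at hm ⊢
    rw [← sum_erase_add A _ hu]
    exact add_le_add hm hd
  · push_cast
    gcongr

end CrossDichotomy

end CrossForm

section Dichotomy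

variable {V : Type*} {G : SimpleGraph V} [DecidableRel G.Adj] {A B : Finset V} {u : V}
  {k m r t : ℕ}

theorem card_eq_and_isCompleteBetween_of_sq_le (hcard : #A + #B = 2 * r)
    (he : r ^ 2 ≤ #(G.interedges A B)) : #A = r ∧ #B = r ∧ G.IsCompleteBetween A B := by
  have hle : #(G.interedges A B) ≤ #A * #B := G.card_interedges_le_mul A B
  have hA : #A = r := by
    zify at *
    nlinarith [sq_nonneg ((#A : ℤ) - r)]
  have hB : #B = r := by lia
  refine ⟨hA, hB, isCompleteBetween_of_card_mul_card_le ?_⟩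
  rwa [hA, hB, ← sq]

theorem card_interedges_le_of_free_even (hfree : (pathGraph (2 * k + 2)).Free G)
    (hcard : #A + #B = 2 * (k + 1)) : #(G.interedges A B) ≤ k * (k + 2) := by
  by_contra! he
  obtain ⟨hA, hB, h⟩ := card_eq_and_isCompleteBetween_of_sq_le hcard (by linarith)
  obtain ⟨u, hu⟩ : A.Nonempty := card_pos.1 (by lia)
  exact hfree ((HasMinCrossDegree.of_isCompleteBetween h hA.ge hB.ge).pathGraph_even_isContained hu)

theorem card_interedges_le_of_free_odd (hk : 1 ≤ k) (hfree : (pathGraph (2 * k + 3)).Free G)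
    (hAB : Disjoint A B) (hcard : #A + #B = 2 * k + 3) (hu : u ∈ A) (hd : degreeIn G B u ≤ k) :
    #(G.interedges A B) ≤ k * (k + 3) := by
  classical
  have hadd : degreeIn G B u + #(G.interedges (A.erase u) B) = #(G.interedges A B) := by
    simp only [card_interedges_eq_sum_degreeIn]
    exact add_sum_erase A _ hu
  have hcard' := card_erase_add_one hu
  obtain he | he := lt_or_ge #(G.interedges (A.erase u) B) ((k + 1) ^ 2)
  · linarith
  obtain ⟨hA, hB, h⟩ := card_eq_and_isCompleteBetween_of_sq_le (by lia) he
  have hle : #(G.interedges (A.erase u) B) ≤ #(A.erase u) * #B := G.card_interedges_le_mul _ _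
  rw [hA, hB] at hle
  have hdeg : degreeIn G B u = 0 := by
    by_contra h0
    obtain ⟨v, hv, -, huv⟩ := exists_adj_of_card_lt_degreeIn (C := ∅) (Nat.pos_of_ne_zero h0)
    exact hfree <| (HasMinCrossDegree.of_isCompleteBetween h hA.ge hB.ge).symm
      |>.pathGraph_odd_isContained_of_adj hv ⟨disjoint_left.1 hAB hu, notMem_erase u A⟩ huv
  linarith

namespace HasMinCrossDegree

theorem degreeIn_eq (h : HasMinCrossDegree G (k + 1) A B)
    (hfree : (pathGraph (2 * k + 3)).Free G) (hu : u ∈ A) : degreeIn G B u = k + 1 :=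
  (h.left u hu).antisymm' <|
    not_lt.1 fun hlt ↦ hfree (h.pathGraph_odd_isContained_of_lt_degreeIn hu hlt)

theorem card_eq (h : HasMinCrossDegree G (k + 1) A B)
    (hfree : (pathGraph (2 * k + 3)).Free G) : #A = #B := by
  have he : #(G.interedges A B) = #(G.interedges B A) := card_interedges_comm
  rw [card_interedges_eq_sum_degreeIn, card_interedges_eq_sum_degreeIn,
    sum_congr rfl fun u hu ↦ h.degreeIn_eq hfree hu,
    sum_congr rfl fun v hv ↦ h.symm.degreeIn_eq hfree hv, sum_const, sum_const] at he
  exact Nat.eq_of_mul_eq_mul_right k.succ_pos he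

theorem crossDichotomy (h : HasMinCrossDegree G (k + 1) A B) (hk : 1 ≤ k)
    (hfree : (pathGraph (2 * k + 3)).Free G) (hm : k + 3 ≤ m) (hcard : #A + #B = k + m) :
    CrossDichotomy G A B (k * m) := by
  refine .inr ⟨(k + 1 : ℕ) * (k + 1 : ℕ), by positivity, ?_, crossBound_of_degreeIn_le
    (fun u hu ↦ (h.degreeIn_eq hfree hu).le) fun v hv ↦ (h.symm.degreeIn_eq hfree hv).le⟩
  have hm' : k + 4 ≤ m := by
    have := h.card_eq hfree
    lia
  exact_mod_cast show (k + 1) * (k + 1) < k * m by nlinarith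

end HasMinCrossDegree

theorem crossDichotomy_of_forall_degreeIn_le (hk : 1 ≤ k)
    (hfree : (pathGraph (2 * k + 3)).Free G) (hm : k + 3 ≤ m)
    (hlow : ∀ {A B : Finset V} {u : V}, Disjoint A B → #A + #B = k + m → u ∈ A →
      degreeIn G B u ≤ k → CrossDichotomy G A B (k * m))
    (hAB : Disjoint A B) (hcard : #A + #B = k + m) : CrossDichotomy G A B (k * m) := by
  by_cases hA : ∃ u ∈ A, degreeIn G B u ≤ k
  · obtain ⟨u, hu, hd⟩ := hA
    exact hlow hAB hcard hu hd
  by_cases hB : ∃ v ∈ B, degreeIn G A v ≤ k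
  · obtain ⟨v, hv, hd⟩ := hB
    exact (hlow hAB.symm (by lia) hv hd).symm
  push Not at hA hB
  exact HasMinCrossDegree.crossDichotomy ⟨hAB, hA, hB⟩ hk hfree hm hcard

theorem crossDichotomy_of_free_odd (hk : 1 ≤ k) (hfree : (pathGraph (2 * k + 3)).Free G)
    (hm : k + 3 ≤ m) (hAB : Disjoint A B) (hcard : #A + #B = k + m) :
    CrossDichotomy G A B (k * m) := by
  classical
  induction m, hm using Nat.le_induction generalizing A B with
  | base =>
    exact crossDichotomy_of_forall_degreeIn_le hk hfree le_rfl
      (fun hAB hcard hu hd ↦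
        .inl (card_interedges_le_of_free_odd hk hfree hAB (by lia) hu hd)) hAB hcard
  | succ m hm ih =>
    refine crossDichotomy_of_forall_degreeIn_le hk hfree (by lia)
      (fun hAB hcard hu hd ↦ ?_) hAB hcard
    have := card_erase_add_one hu
    exact (ih (hAB.mono_left (erase_subset _ _)) (by lia)).of_erase hu hd

theorem crossDichotomy_of_free (hk : k = (t - 2) / 2) (ht : t ≤ k + m) (ht3 : t ≠ 3)
    (hfree : (pathGraph t).Free G) (hAB : Disjoint A B) (hcard : #A + #B = k + m) :
    CrossDichotomy G A B (k * m) := by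
  obtain ht2 | ht2 := le_or_gt t 2
  · refine .inl ?_
    have hadj (u v : V) : ¬ G.Adj u v :=
      not_adj_of_free_pathGraph_two (free_pathGraph_mono ht2 hfree)
    simp [interedges_def, hadj]
  obtain hm | hm := le_or_gt (k + 3) m
  · exact crossDichotomy_of_free_odd (by lia) (free_pathGraph_mono (by lia) hfree) hm hAB hcard
  · obtain rfl : m = k + 2 := by lia
    exact .inl (card_interedges_le_of_free_even (free_pathGraph_mono (by lia) hfree) (by lia))

end Dichotomy

section EqualityCase

variable {V : Type*} {G : SimpleGraph V} [DecidableRel G.Adj] {A B : Finset V} {u v : V}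
  {a b : V → ℝ} {c : ℝ}

theorem sq_two_mul_crossForm_le (h : CrossBound G A B c) (hc : 0 ≤ c) :
    (2 * crossForm G A B a b) ^ 2 ≤ (√c * (∑ u ∈ A, a u ^ 2 + ∑ v ∈ B, b v ^ 2)) ^ 2 := by
  have hAMGM := four_mul_le_pow_two_add (∑ u ∈ A, a u ^ 2) (∑ v ∈ B, b v ^ 2)
  rw [mul_pow √c, Real.sq_sqrt hc]
  linarith [h a b, mul_le_mul_of_nonneg_left hAMGM hc]

theorem neg_sqrt_mul_le_two_mul_crossForm (h : CrossBound G A B c) (hc : 0 ≤ c) :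
    -√c * (∑ u ∈ A, a u ^ 2 + ∑ v ∈ B, b v ^ 2) ≤ 2 * crossForm G A B a b := by
  rw [neg_mul]
  exact (abs_le_of_sq_le_sq' (sq_two_mul_crossForm_le h hc) (by positivity)).1

theorem sum_mul_sub_ite_sq (s : ℝ) :
    ∑ u ∈ A, ∑ v ∈ B, (a u * b v - if G.Adj u v then s else 0) ^ 2 =
      (∑ u ∈ A, a u ^ 2) * (∑ v ∈ B, b v ^ 2) - 2 * s * crossForm G A B a b +
        #(G.interedges A B) * s ^ 2 := by
  have hsq (u v : V) : (a u * b v - if G.Adj u v then s else 0) ^ 2 =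
      a u ^ 2 * b v ^ 2 - 2 * s * (if G.Adj u v then a u * b v else 0) +
        if G.Adj u v then s ^ 2 else 0 := by
    split_ifs <;> ring
  have hs : #(G.interedges A B) * s ^ 2 = ∑ p ∈ G.interedges A B, s ^ 2 := by
    rw [sum_const, nsmul_eq_mul]
  rw [hs, sum_interedges fun _ _ ↦ s ^ 2, crossForm, sum_interedges fun u v ↦ a u * b v,
    sum_mul_sum]
  simp only [hsq, sum_filter, sum_add_distrib, sum_sub_distrib, mul_sum]

/-- This is the equality case of `crossBound_card_interedges`. -/
theorem mul_eq_ite_of_two_mul_crossForm_le (hE : #(G.interedges A B) ≤ c) (hc : 0 < c)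
    (h : 2 * crossForm G A B a b ≤ -√c * (∑ u ∈ A, a u ^ 2 + ∑ v ∈ B, b v ^ 2))
    (hu : u ∈ A) (hv : v ∈ B) :
    a u * b v = if G.Adj u v then crossForm G A B a b / c else 0 := by
  set F := crossForm G A B a b
  set P := ∑ u ∈ A, a u ^ 2
  set Q := ∑ v ∈ B, b v ^ 2
  have hFsq : c * (P * Q) ≤ F ^ 2 := by
    have hsq : (√c * (P + Q)) ^ 2 ≤ (-(2 * F)) ^ 2 := by
      gcongr
      linarith
    rw [mul_pow, Real.sq_sqrt hc.le] at hsq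
    linarith [mul_le_mul_of_nonneg_left (four_mul_le_pow_two_add P Q) hc.le]
  have hsum : ∑ u ∈ A, ∑ v ∈ B, (a u * b v - if G.Adj u v then F / c else 0) ^ 2 ≤ 0 :=
    calc ∑ u ∈ A, ∑ v ∈ B, (a u * b v - if G.Adj u v then F / c else 0) ^ 2
      _ = P * Q - 2 * (F / c) * F + #(G.interedges A B) * (F / c) ^ 2 := sum_mul_sub_ite_sq _
      _ ≤ P * Q - 2 * (F / c) * F + c * (F / c) ^ 2 := by gcongr
      _ = (c * (P * Q) - F ^ 2) / c := by field_simp; ring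
      _ ≤ 0 := div_nonpos_of_nonpos_of_nonneg (sub_nonpos.2 hFsq) hc.le
  have hrow : ∑ v ∈ B, (a u * b v - if G.Adj u v then F / c else 0) ^ 2 ≤ 0 :=
    (single_le_sum (f := fun u ↦ ∑ v ∈ B, (a u * b v - if G.Adj u v then F / c else 0) ^ 2)
      (fun u _ ↦ sum_nonneg fun v _ ↦ sq_nonneg _) hu).trans hsum
  have hterm : (a u * b v - if G.Adj u v then F / c else 0) ^ 2 ≤ 0 :=
    (single_le_sum (f := fun v ↦ (a u * b v - if G.Adj u v then F / c else 0) ^ 2)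
      (fun v _ ↦ sq_nonneg _) hv).trans hrow
  exact sub_eq_zero.1 (sq_nonpos_iff _ |>.1 hterm)

end EqualityCase

section Spectral

variable {V : Type*} {G : SimpleGraph V} {P Q : Finset V}

/-- The vertices of `P ∪ Q` span the complete bipartite graph with parts `P` and `Q`, and no edge
joins them to another vertex. -/
structure IsBicliqueComponent (G : SimpleGraph V) (P Q : Finset V) : Prop where
  left : ∀ u ∈ P, ∀ v, G.Adj u v ↔ v ∈ Q
  right : ∀ v ∈ Q, ∀ u, G.Adj v u ↔ u ∈ P

theorem IsBicliqueComponent.symm (h : IsBicliqueComponent G P Q) : IsBicliqueComponent G Q P :=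
  ⟨h.right, h.left⟩

variable [Fintype V] {x : V → ℝ} {u v : V} {c : ℝ}

theorem dotProduct_self_pos (hx : x ≠ 0) : 0 < x ⬝ᵥ x := by
  simpa only [star_trivial] using dotProduct_star_self_pos_iff.2 hx

/-- The side of the vertex bipartition induced by the signs of `x` that contains the zeros. -/
noncomputable def nonnegSet (x : V → ℝ) : Finset V := {u | 0 ≤ x u}

theorem mem_nonnegSet : u ∈ nonnegSet x ↔ 0 ≤ x u := by
  simp [nonnegSet]

variable [DecidableRel G.Adj]

theorem crossForm_nonnegSet_nonneg : 0 ≤ crossForm G (nonnegSet x) (nonnegSet x) x x :=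
  crossForm_self_nonneg fun _ hu _ hv ↦ mul_nonneg (mem_nonnegSet.1 hu) (mem_nonnegSet.1 hv)

variable [DecidableEq V]

theorem mem_compl_nonnegSet : u ∈ (nonnegSet x)ᶜ ↔ x u < 0 := by
  simp [nonnegSet]

/-- The factor `2` is absent from the outer terms because `G.interedges A A` already contains each
edge in both orientations. -/
theorem dotProduct_adjMatrix_mulVec (A : Finset V) (x : V → ℝ) :
    x ⬝ᵥ G.adjMatrix ℝ *ᵥ x =
      crossForm G A A x x + 2 * crossForm G A Aᶜ x x + crossForm G Aᶜ Aᶜ x x := by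
  have hrow (B : Finset V) : crossForm G B A x x + crossForm G B Aᶜ x x =
      ∑ u ∈ B, ∑ v, if G.Adj u v then x u * x v else 0 := by
    simp only [crossForm, sum_interedges fun u v ↦ x u * x v, sum_filter, ← sum_add_distrib,
      sum_add_sum_compl]
  have hcomm : crossForm G Aᶜ A x x = crossForm G A Aᶜ x x := crossForm_comm
  rw [dotProduct_mulVec_adjMatrix, ← sum_add_sum_compl A, ← hrow, ← hrow, hcomm]
  ring

theorem dotProduct_self_eq (A : Finset V) (x : V → ℝ) :
    x ⬝ᵥ x = ∑ u ∈ A, x u ^ 2 + ∑ v ∈ Aᶜ, x v ^ 2 := by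
  rw [sum_add_sum_compl, dotProduct]
  simp only [sq]

theorem crossForm_compl_nonnegSet_nonneg : 0 ≤ crossForm G (nonnegSet x)ᶜ (nonnegSet x)ᶜ x x :=
  crossForm_self_nonneg fun _ hu _ hv ↦
    (mul_pos_of_neg_of_neg (mem_compl_nonnegSet.1 hu) (mem_compl_nonnegSet.1 hv)).le

theorem neg_sqrt_mul_le_dotProduct (h : CrossBound G (nonnegSet x) (nonnegSet x)ᶜ c)
    (hc : 0 ≤ c) : -√c * (x ⬝ᵥ x) ≤ x ⬝ᵥ G.adjMatrix ℝ *ᵥ x := by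
  have hcross := neg_sqrt_mul_le_two_mul_crossForm (a := x) (b := x) h hc
  rw [dotProduct_self_eq (nonnegSet x), dotProduct_adjMatrix_mulVec (nonnegSet x)]
  linarith [crossForm_nonnegSet_nonneg (G := G) (x := x),
    crossForm_compl_nonnegSet_nonneg (G := G) (x := x)]

/-- A vector at which the edge-count bound on the Rayleigh quotient is attained: `x` is a nonzero
vector whose sign bipartition has at most `c` edges, and the quotient is at most `-√c`. -/
structure IsExtremalVector (G : SimpleGraph V) [DecidableRel G.Adj] (c : ℝ) (x : V → ℝ) :
    Prop where
  ne_zero : x ≠ 0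
  card_interedges_le : #(G.interedges (nonnegSet x) (nonnegSet x)ᶜ) ≤ c
  dotProduct_le : x ⬝ᵥ G.adjMatrix ℝ *ᵥ x ≤ -√c * (x ⬝ᵥ x)

namespace IsExtremalVector

theorem two_mul_crossForm_add_le (h : IsExtremalVector G c x) :
    2 * crossForm G (nonnegSet x) (nonnegSet x)ᶜ x x +
      crossForm G (nonnegSet x)ᶜ (nonnegSet x)ᶜ x x ≤ -√c * (x ⬝ᵥ x) := by
  have := h.dotProduct_le
  rw [dotProduct_adjMatrix_mulVec (nonnegSet x)] at this
  linarith [crossForm_nonnegSet_nonneg (G := G) (x := x)]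

theorem two_mul_crossForm_le (h : IsExtremalVector G c x) :
    2 * crossForm G (nonnegSet x) (nonnegSet x)ᶜ x x ≤ -√c * (x ⬝ᵥ x) :=
  (le_add_of_nonneg_right crossForm_compl_nonnegSet_nonneg).trans h.two_mul_crossForm_add_le

theorem crossForm_neg (h : IsExtremalVector G c x) (hc : 0 < c) :
    crossForm G (nonnegSet x) (nonnegSet x)ᶜ x x < 0 := by
  have hx : 0 < √c * (x ⬝ᵥ x) := mul_pos (Real.sqrt_pos.2 hc) (dotProduct_self_pos h.ne_zero)
  linarith [h.two_mul_crossForm_le]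

theorem mul_eq_ite (h : IsExtremalVector G c x) (hc : 0 < c) (hu : 0 ≤ x u) (hv : x v < 0) :
    x u * x v =
      if G.Adj u v then crossForm G (nonnegSet x) (nonnegSet x)ᶜ x x / c else 0 :=
  mul_eq_ite_of_two_mul_crossForm_le h.card_interedges_le hc
    (dotProduct_self_eq (nonnegSet x) x ▸ h.two_mul_crossForm_le)
    (mem_nonnegSet.2 hu) (mem_compl_nonnegSet.2 hv)

theorem not_adj_of_neg_of_neg (h : IsExtremalVector G c x) (hc : 0 ≤ c) (hu : x u < 0)
    (hv : x v < 0) : ¬ G.Adj u v := by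
  intro huv
  have hpos : 0 < crossForm G (nonnegSet x)ᶜ (nonnegSet x)ᶜ x x := by
    refine sum_pos' (fun p hp ↦ ?_) ⟨(u, v), (mk_mem_interedges_iff G).2
      ⟨mem_compl_nonnegSet.2 hu, mem_compl_nonnegSet.2 hv, huv⟩, mul_pos_of_neg_of_neg hu hv⟩
    have hp' := (mk_mem_interedges_iff G).1 hp
    exact (mul_pos_of_neg_of_neg (mem_compl_nonnegSet.1 hp'.1)
      (mem_compl_nonnegSet.1 hp'.2.1)).le
  have hbound := neg_sqrt_mul_le_two_mul_crossForm (a := x) (b := x)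
    (crossBound_card_interedges.mono h.card_interedges_le) hc
  rw [← dotProduct_self_eq] at hbound
  linarith [h.two_mul_crossForm_add_le]

theorem adj_iff_pos_of_neg (h : IsExtremalVector G c x) (hc : 0 < c) (hv : x v < 0) :
    G.Adj v u ↔ 0 < x u := by
  rw [G.adj_comm]
  obtain hu | hu := lt_or_ge (x u) 0
  · exact iff_of_false (h.not_adj_of_neg_of_neg hc.le hu hv) hu.not_gt
  have hmul := h.mul_eq_ite hc hu hv
  split_ifs at hmul with huv
  · exact iff_of_true huv <|
      pos_of_mul_neg_left (hmul.trans_lt (div_neg_of_neg_of_pos (h.crossForm_neg hc) hc)) hv.le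
  · exact iff_of_false huv ((mul_eq_zero_iff_right hv.ne).1 hmul).le.not_gt

theorem isBicliqueComponent (h : IsExtremalVector G c x) (hneg : IsExtremalVector G c (-x))
    (hc : 0 < c) : IsBicliqueComponent G {u | 0 < x u} {u | x u < 0} where
  left u hu v := by
    have hu' : (-x) u < 0 := neg_neg_iff_pos.2 ((mem_filter_univ u).1 hu)
    rw [hneg.adj_iff_pos_of_neg hc hu', mem_filter_univ, Pi.neg_apply, neg_pos]
  right v hv u := by
    rw [h.adj_iff_pos_of_neg hc ((mem_filter_univ v).1 hv), mem_filter_univ]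

theorem card_interedges_eq (h : IsExtremalVector G c x) (hc : 0 < c) :
    #(G.interedges (nonnegSet x) (nonnegSet x)ᶜ) = c := by
  set F := crossForm G (nonnegSet x) (nonnegSet x)ᶜ x x
  have hFne : F ≠ 0 := (h.crossForm_neg hc).ne
  have hsum : F = #(G.interedges (nonnegSet x) (nonnegSet x)ᶜ) * (F / c) := by
    rw [← nsmul_eq_mul, ← sum_const]
    refine sum_congr rfl fun p hp ↦ ?_
    have hp' := (mk_mem_interedges_iff G).1 hp
    rw [h.mul_eq_ite hc (mem_nonnegSet.1 hp'.1) (mem_compl_nonnegSet.1 hp'.2.1), if_pos hp'.2.2]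
  field_simp at hsum
  exact hsum.symm

theorem card_mul_card (h : IsExtremalVector G c x) (hc : 0 < c) :
    (#{u | 0 < x u} * #{u | x u < 0} : ℝ) = c := by
  rw [← h.card_interedges_eq hc, ← Nat.cast_mul, ← card_product]
  congr 2
  ext ⟨u, v⟩
  rw [mk_mem_interedges_iff, mem_product, mem_filter_univ, mem_filter_univ, mem_nonnegSet,
    mem_compl_nonnegSet]
  constructor
  · rintro ⟨hu, hv⟩
    exact ⟨hu.le, hv, ((h.adj_iff_pos_of_neg hc hv).2 hu).symm⟩
  · rintro ⟨-, hv, huv⟩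
    exact ⟨(h.adj_iff_pos_of_neg hc hv).1 huv.symm, hv⟩

end IsExtremalVector

theorem exists_adjMatrix_mulVec_eq {μ : ℝ} (hμ : μ ∈ spectrum ℝ (G.adjMatrix ℝ)) :
    ∃ x : V → ℝ, x ≠ 0 ∧ G.adjMatrix ℝ *ᵥ x = μ • x := by
  rw [← spectrum_toLin', ← Module.End.hasEigenvalue_iff_mem_spectrum] at hμ
  obtain ⟨x, hx⟩ := hμ.exists_hasEigenvector
  exact ⟨x, hx.2, by simpa only [toLin'_apply] using hx.apply_eq_smul⟩

theorem exists_dotProduct_eq_leastEigenvalue_mul [Nonempty V] :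
    ∃ x : V → ℝ, x ≠ 0 ∧ x ⬝ᵥ G.adjMatrix ℝ *ᵥ x = G.leastEigenvalue * (x ⬝ᵥ x) := by
  obtain ⟨x, hx0, hx⟩ := exists_adjMatrix_mulVec_eq G.isLeast_leastEigenvalue.1
  exact ⟨x, hx0, by rw [hx, dotProduct_smul, smul_eq_mul]⟩

theorem neg_sqrt_le_leastEigenvalue [Nonempty V] (h : ∀ A : Finset V, CrossBound G A Aᶜ c)
    (hc : 0 ≤ c) : -√c ≤ G.leastEigenvalue := by
  obtain ⟨x, hx0, hx⟩ := exists_dotProduct_eq_leastEigenvalue_mul (G := G)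
  exact le_of_mul_le_mul_right (hx ▸ neg_sqrt_mul_le_dotProduct (h _) hc) (dotProduct_self_pos hx0)

theorem CrossDichotomy.isExtremalVector {m : ℕ}
    (h : CrossDichotomy G (nonnegSet x) (nonnegSet x)ᶜ m) (hx0 : x ≠ 0)
    (hx : x ⬝ᵥ G.adjMatrix ℝ *ᵥ x ≤ -√m * (x ⬝ᵥ x)) : IsExtremalVector G m x := by
  refine ⟨hx0, ?_, hx⟩
  obtain hm | ⟨c, hc, hcm, hbound⟩ := h
  · exact Nat.cast_le.2 hm
  · have hle := (neg_sqrt_mul_le_dotProduct hbound hc).trans hx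
    have hsqrt := le_of_mul_le_mul_right hle (dotProduct_self_pos hx0)
    exact absurd (Real.sqrt_lt_sqrt hc hcm) (neg_le_neg_iff.1 hsqrt).not_gt

theorem exists_isBicliqueComponent [Nonempty V] {m : ℕ}
    (h : ∀ A : Finset V, CrossDichotomy G A Aᶜ m) (hm : 0 < m)
    (hle : G.leastEigenvalue ≤ -√m) :
    ∃ P Q : Finset V, IsBicliqueComponent G P Q ∧ #P * #Q = m := by
  obtain ⟨x, hx0, hx⟩ := exists_dotProduct_eq_leastEigenvalue_mul (G := G)
  have hxle : x ⬝ᵥ G.adjMatrix ℝ *ᵥ x ≤ -√m * (x ⬝ᵥ x) :=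
    hx.trans_le (mul_le_mul_of_nonneg_right hle (dotProduct_self_pos hx0).le)
  have hext : IsExtremalVector G m x := (h _).isExtremalVector hx0 hxle
  have hext' : IsExtremalVector G m (-x) :=
    (h _).isExtremalVector (neg_ne_zero.2 hx0) (by simpa [mulVec_neg] using hxle)
  have hm' : (0 : ℝ) < m := Nat.cast_pos.2 hm
  exact ⟨_, _, hext.isBicliqueComponent hext' hm', mod_cast hext.card_mul_card hm'⟩

end Spectral

section Interlacing

variable {V : Type*} [Fintype V] [DecidableEq V] [Nonempty V] {G : SimpleGraph V}
  [DecidableRel G.Adj]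

theorem posSemidef_adjMatrix_sub_leastEigenvalue :
    (G.adjMatrix ℝ - G.leastEigenvalue • (1 : Matrix V V ℝ)).PosSemidef := by
  refine posSemidef_iff_isHermitian_and_spectrum_nonneg.2
    ⟨(G.isHermitian_adjMatrix ℝ).sub (isHermitian_one.smul (.all _)), ?_⟩
  rw [← Algebra.algebraMap_eq_smul_one, ← spectrum.sub_singleton_eq]
  rintro _ ⟨μ, hμ, _, rfl, rfl⟩
  exact sub_nonneg.2 (G.isLeast_leastEigenvalue.2 hμ)

theorem leastEigenvalue_mul_dotProduct_le {W : Type*} [Fintype W] {H : SimpleGraph W}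
    [DecidableRel H.Adj] (φ : H ↪g G) (y : W → ℝ) :
    G.leastEigenvalue * (y ⬝ᵥ y) ≤ y ⬝ᵥ H.adjMatrix ℝ *ᵥ y := by
  classical
  have hsub : (G.adjMatrix ℝ - G.leastEigenvalue • 1).submatrix φ φ =
      H.adjMatrix ℝ - G.leastEigenvalue • 1 := by
    ext u v
    simp [adjMatrix_apply, one_apply]
  have h := (posSemidef_adjMatrix_sub_leastEigenvalue (G := G)).submatrix φ
  rw [hsub] at h
  simpa [sub_mulVec, smul_mulVec] using h.dotProduct_mulVec_nonneg y

theorem leastEigenvalue_nonpos : G.leastEigenvalue ≤ 0 := by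
  obtain ⟨u⟩ := ‹Nonempty V›
  simpa using leastEigenvalue_mul_dotProduct_le (Embedding.refl (G := G)) (Pi.single u 1)

theorem leastEigenvalue_le_of_completeBipartiteGraph_embedding {α β : Type*} [Fintype α]
    [Fintype β] (φ : completeBipartiteGraph α β ↪g G) :
    G.leastEigenvalue ≤ -√(Fintype.card α * Fintype.card β) := by
  classical
  set p : ℝ := (Fintype.card α : ℝ) with hp
  set q : ℝ := (Fintype.card β : ℝ) with hq
  have hp0 : 0 ≤ p := Nat.cast_nonneg _
  have hq0 : 0 ≤ q := Nat.cast_nonneg _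
  obtain h0 | hpq := (mul_nonneg hp0 hq0).eq_or_lt
  · rw [← h0, Real.sqrt_zero, neg_zero]
    exact leastEigenvalue_nonpos
  let y : α ⊕ β → ℝ := Sum.elim (fun _ ↦ √q) fun _ ↦ -√p
  have hnorm : y ⬝ᵥ y = 2 * (p * q) := by
    simp only [y, dotProduct, Fintype.sum_sum_type, Sum.elim_inl, Sum.elim_inr, sum_const,
      card_univ, nsmul_eq_mul, ← hp, ← hq, neg_mul_neg, Real.mul_self_sqrt, hp0, hq0]
    ring
  have hform : y ⬝ᵥ (completeBipartiteGraph α β).adjMatrix ℝ *ᵥ y =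
      -√(p * q) * (2 * (p * q)) := by
    simp only [y, dotProduct_mulVec_adjMatrix, Fintype.sum_sum_type, completeBipartiteGraph_adj,
      Sum.isLeft_inl, Sum.isLeft_inr, Sum.isRight_inl, Sum.isRight_inr, Sum.elim_inl,
      Sum.elim_inr, Bool.false_eq_true, and_true, and_false, or_false, false_or, if_true,
      if_false, sum_const, card_univ, nsmul_eq_mul, mul_zero, zero_add, add_zero, ← hp, ← hq,
      Real.sqrt_mul hp0]
    ring
  have h := leastEigenvalue_mul_dotProduct_le φ y
  rw [hnorm, hform] at h
  exact le_of_mul_le_mul_right h (by positivity)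

end Interlacing

section Classification

variable {V : Type*} {G : SimpleGraph V} {P Q : Finset V}

namespace IsBicliqueComponent

theorem isCompleteBetween (h : IsBicliqueComponent G P Q) : G.IsCompleteBetween P Q :=
  fun u hu v hv ↦ (h.left u hu v).2 hv

theorem disjoint (h : IsBicliqueComponent G P Q) : Disjoint P Q :=
  disjoint_coe.1 h.isCompleteBetween.disjoint

theorem nonempty_iso_sum [DecidableEq V] (h : IsBicliqueComponent G P Q) :
    Nonempty (G ≃g completeBipartiteGraph (Fin #P) (Fin #Q) ⊕g G.induce {v | v ∉ P ∪ Q}) := by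
  have hP : ∀ u ∈ P, u ∉ Q := fun _ hu ↦ Finset.disjoint_left.1 h.disjoint hu
  have hQ : ∀ u ∈ Q, u ∉ P := fun _ hu ↦ Finset.disjoint_right.1 h.disjoint hu
  have hR : ∀ u : ↥{v | v ∉ P ∪ Q}, ↑u ∉ P ∧ ↑u ∉ Q := fun u ↦ notMem_union.1 u.2
  let φ : completeBipartiteGraph P Q ⊕g G.induce {v | v ∉ P ∪ Q} ≃g G := by
    refine ⟨((Equiv.Finset.union P Q h.disjoint).sumCongr (.refl _)).trans
      (.sumCompl (· ∈ P ∪ Q)), ?_⟩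
    rintro ((⟨u, hu⟩ | ⟨u, hu⟩) | u) ((⟨v, hv⟩ | ⟨v, hv⟩) | v) <;> change G.Adj u v ↔ _ <;>
      simp [h.left, h.right, G.adj_comm u, *]
  exact ⟨φ.symm.trans ((completeBipartiteGraphCongr P.equivFin Q.equivFin).sumCongr .refl)⟩

variable [Fintype V]

theorem card_compl_add [DecidableEq V] (h : IsBicliqueComponent G P Q) :
    Fintype.card {v // v ∉ P ∪ Q} + (#P + #Q) = Fintype.card V := by
  rw [← card_union_of_disjoint h.disjoint, Fintype.card_subtype_compl, Fintype.card_coe]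
  exact Nat.sub_add_cancel (card_le_univ _)

theorem nonempty_iso_completeBipartiteGraph (h : IsBicliqueComponent G P Q)
    (hcard : Fintype.card V = #P + #Q) :
    Nonempty (G ≃g completeBipartiteGraph (Fin #P) (Fin #Q)) := by
  classical
  obtain ⟨φ⟩ := h.nonempty_iso_sum
  have hempty : IsEmpty {v // v ∉ P ∪ Q} := by
    rw [← Fintype.card_eq_zero_iff]
    have := h.card_compl_add
    lia
  refine ⟨φ.trans ⟨Equiv.sumEmpty _ {v // v ∉ P ∪ Q}, ?_⟩⟩
  rintro (a | a) (b | b)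
  · simp
  all_goals exact hempty.elim ‹_›

theorem nonempty_iso_completeBipartiteGraph_sum_top (h : IsBicliqueComponent G P Q)
    (hcard : Fintype.card V = #P + #Q + 1) :
    Nonempty (G ≃g completeBipartiteGraph (Fin #P) (Fin #Q) ⊕g (⊤ : SimpleGraph (Fin 1))) := by
  classical
  obtain ⟨φ⟩ := h.nonempty_iso_sum
  have hrest : Fintype.card {v // v ∉ P ∪ Q} = 1 := by
    have := h.card_compl_add
    lia
  let e : ↥{v | v ∉ P ∪ Q} ≃ Fin 1 := Fintype.equivFinOfCardEq hrest
  refine ⟨φ.trans (Iso.refl.sumCongr ⟨e, ?_⟩)⟩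
  intro a b
  simp [e.subsingleton.elim a b]

end IsBicliqueComponent

end Classification

section Extremal

variable {V : Type*} {G : SimpleGraph V} {P Q : Finset V} {k m p q t : ℕ}

theorem IsBicliqueComponent.card_eq_two_of_free (h : IsBicliqueComponent G P Q)
    (hk : k = (t - 2) / 2) (ht : t ≤ k + m) (hfree : (pathGraph t).Free G)
    (hmul : #P * #Q = k * m) (hP : k < #P) (hQ : k < #Q) :
    t = 5 ∧ k = 1 ∧ m = 4 ∧ #P = 2 ∧ #Q = 2 := by
  classical
  have hdeg : HasMinCrossDegree G (k + 1) P Q := .of_isCompleteBetween h.isCompleteBetween hP hQ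
  obtain ⟨u, hu⟩ : P.Nonempty := card_pos.1 (by lia)
  obtain rfl : t = 2 * k + 3 := by
    by_contra htk
    exact free_pathGraph_mono (by lia) hfree (hdeg.pathGraph_even_isContained hu)
  have hPQ : #P = #Q := hdeg.card_eq hfree
  have hQk : #Q = k + 1 :=
    (degreeIn_eq_card (h.isCompleteBetween hu)).symm.trans (hdeg.degreeIn_eq hfree hu)
  rw [hPQ, hQk] at hmul
  obtain rfl : k = 1 := by nlinarith
  lia

variable [Fintype V]

theorem eq_and_eq_of_mul_eq_mul (hk : 0 < k) (hkm : k ≤ m) (hp : p ≤ k) (hpq : p + q ≤ k + m)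
    (h : p * q = k * m) : p = k ∧ q = m := by
  obtain ⟨d, rfl⟩ := Nat.exists_eq_add_of_le hp
  obtain rfl | hd := d.eq_zero_or_pos
  · exact ⟨rfl, Nat.eq_of_mul_eq_mul_left hk h⟩
  · have : p * q ≤ p * (d + m) := Nat.mul_le_mul_left p (by lia)
    nlinarith

theorem IsBicliqueComponent.nonempty_iso_of_card_le (h : IsBicliqueComponent G P Q)
    (hV : Fintype.card V = k + m) (hk : 0 < k) (hkm : k ≤ m) (hP : #P ≤ k)
    (hPQ : #P * #Q = k * m) : Nonempty (G ≃g completeBipartiteGraph (Fin k) (Fin m)) := by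
  classical
  have hcard := h.card_compl_add
  obtain ⟨rfl, rfl⟩ := eq_and_eq_of_mul_eq_mul hk hkm hP (by lia) hPQ
  exact h.nonempty_iso_completeBipartiteGraph hV

variable [DecidableEq V] [DecidableRel G.Adj]

theorem isBicliqueComponent_empty_univ (h : ∀ A, CrossDichotomy G A Aᶜ 0) :
    IsBicliqueComponent G ∅ univ := by
  have hadj : ∀ u v, ¬ G.Adj u v := by
    intro u v huv
    obtain he | ⟨c, hc, hc0, -⟩ := h {u}
    · rw [Nat.le_zero, card_eq_zero] at he
      refine notMem_empty (u, v) (he ▸ G.mk_mem_interedges_iff.2 ?_)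
      simpa [huv] using huv.ne'
    · exact hc0.not_ge (by simpa using hc)
  constructor <;> simp [hadj]

theorem crossDichotomy_balanced (hkm : k ≤ m) (hmk : m ≤ k + 1)
    (hV : Fintype.card V = k + m) (A : Finset V) : CrossDichotomy G A Aᶜ (k * m) := by
  have hcard := card_add_card_compl A
  refine .inl ((G.card_interedges_le_mul A Aᶜ).trans ?_)
  obtain hm | hm : m = k ∨ m = k + 1 := by lia
  all_goals
    rw [hm] at hV ⊢
    rw [hV] at hcard
    zify at *
    nlinarith [sq_nonneg (2 * (#A : ℤ) - 2 * k - 1), sq_nonneg ((#A : ℤ) - k)]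

theorem crossDichotomy_compl_of_free (hV : Fintype.card V = k + m) (hk : k = (t - 2) / 2)
    (ht : t ≤ k + m) (ht3 : t ≠ 3) (hfree : (pathGraph t).Free G) (A : Finset V) :
    CrossDichotomy G A Aᶜ (k * m) :=
  crossDichotomy_of_free hk ht ht3 hfree disjoint_compl_right
    ((card_add_card_compl A).trans hV)

variable [Nonempty V]

theorem nonempty_iso_or_exists_isBicliqueComponent (hV : Fintype.card V = k + m) (hkm : k ≤ m)
    (h : ∀ A, CrossDichotomy G A Aᶜ (k * m)) (hle : G.leastEigenvalue ≤ -√(k * m)) :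
    Nonempty (G ≃g completeBipartiteGraph (Fin k) (Fin m)) ∨
      ∃ P Q, IsBicliqueComponent G P Q ∧ #P * #Q = k * m ∧ k < #P ∧ k < #Q := by
  obtain rfl | hk := k.eq_zero_or_pos
  · rw [zero_mul] at h
    have hiso := (isBicliqueComponent_empty_univ h).nonempty_iso_completeBipartiteGraph (by simp)
    rw [card_empty, card_univ, hV, zero_add] at hiso
    exact .inl hiso
  obtain ⟨P, Q, hPQ, hmul⟩ := exists_isBicliqueComponent h (Nat.mul_pos hk (hk.trans_le hkm))
    (by exact_mod_cast hle)
  obtain hP | hP := le_or_gt #P k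
  · exact .inl (hPQ.nonempty_iso_of_card_le hV hk hkm hP hmul)
  obtain hQ | hQ := le_or_gt #Q k
  · exact .inl (hPQ.symm.nonempty_iso_of_card_le hV hk hkm hQ ((mul_comm _ _).trans hmul))
  exact .inr ⟨P, Q, hPQ, hmul, hP, hQ⟩

theorem leastEigenvalue_le_of_embedding
    (φ : completeBipartiteGraph (Fin k) (Fin m) ↪g G) : G.leastEigenvalue ≤ -√(k * m) := by
  simpa using leastEigenvalue_le_of_completeBipartiteGraph_embedding φ

theorem neg_sqrt_le_leastEigenvalue_of_crossDichotomy
    (h : ∀ A, CrossDichotomy G A Aᶜ (k * m)) : -√(k * m) ≤ G.leastEigenvalue := by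
  have := neg_sqrt_le_leastEigenvalue (fun A ↦ (h A).crossBound) (Nat.cast_nonneg _)
  exact_mod_cast this

theorem neg_sqrt_le_leastEigenvalue_balanced (hV : Fintype.card V = k + m) (hkm : k ≤ m)
    (hmk : m ≤ k + 1) : -√(k * m) ≤ G.leastEigenvalue :=
  neg_sqrt_le_leastEigenvalue_of_crossDichotomy (crossDichotomy_balanced hkm hmk hV)

theorem leastEigenvalue_eq_iff_balanced (hV : Fintype.card V = k + m) (hkm : k ≤ m)
    (hmk : m ≤ k + 1) :
    G.leastEigenvalue = -√(k * m) ↔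
      Nonempty (G ≃g completeBipartiteGraph (Fin k) (Fin m)) := by
  refine ⟨fun heq ↦ ?_, fun ⟨φ⟩ ↦ (leastEigenvalue_le_of_embedding φ.symm.toEmbedding).antisymm
    (neg_sqrt_le_leastEigenvalue_balanced hV hkm hmk)⟩
  refine (nonempty_iso_or_exists_isBicliqueComponent hV hkm (crossDichotomy_balanced hkm hmk hV)
    heq.le).resolve_right ?_
  rintro ⟨P, Q, hPQ, -, hP, hQ⟩
  have := hPQ.card_compl_add
  lia

theorem neg_sqrt_le_leastEigenvalue_of_free (hV : Fintype.card V = k + m) (hk : k = (t - 2) / 2)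
    (ht : t ≤ k + m) (ht3 : t ≠ 3) (hfree : (pathGraph t).Free G) :
    -√(k * m) ≤ G.leastEigenvalue :=
  neg_sqrt_le_leastEigenvalue_of_crossDichotomy
    (crossDichotomy_compl_of_free hV hk ht ht3 hfree)

theorem leastEigenvalue_eq_iff_of_free (hV : Fintype.card V = k + m) (hk : k = (t - 2) / 2)
    (ht : t ≤ k + m) (ht3 : t ≠ 3) (hfree : (pathGraph t).Free G) :
    G.leastEigenvalue = -√(k * m) ↔
      Nonempty (G ≃g completeBipartiteGraph (Fin k) (Fin m)) ∨
      (k + m = 5 ∧ t = 5 ∧ Nonempty (G ≃g completeBipartiteGraph (Fin 2) (Fin 2) ⊕g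
        (⊤ : SimpleGraph (Fin 1)))) := by
  have hge := neg_sqrt_le_leastEigenvalue_of_free hV hk ht ht3 hfree
  constructor
  · intro heq
    refine (nonempty_iso_or_exists_isBicliqueComponent hV (by lia)
      (crossDichotomy_compl_of_free hV hk ht ht3 hfree) heq.le).imp_right ?_
    rintro ⟨P, Q, hPQ, hmul, hP, hQ⟩
    obtain ⟨rfl, rfl, rfl, hP2, hQ2⟩ := hPQ.card_eq_two_of_free hk ht hfree hmul hP hQ
    have hiso := hPQ.nonempty_iso_completeBipartiteGraph_sum_top (by lia)
    rw [hP2, hQ2] at hiso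
    exact ⟨rfl, rfl, hiso⟩
  · rintro (⟨⟨φ⟩⟩ | ⟨hn, rfl, ⟨φ⟩⟩)
    · exact (leastEigenvalue_le_of_embedding φ.symm.toEmbedding).antisymm hge
    · obtain ⟨rfl, rfl⟩ : k = 1 ∧ m = 4 := by lia
      refine hge.antisymm' ?_
      have := leastEigenvalue_le_of_embedding (φ.symm.toEmbedding.comp Embedding.sumInl)
      norm_num at this ⊢
      exact this

end Extremal

end PathFree

theorem theorem1p4 {V : Type*} [Fintype V] [DecidableEq V] [Nonempty V]
    (G : SimpleGraph V) [DecidableRel G.Adj] (n t k : ℕ)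
    (hn : Fintype.card V = n) (hk : k = (t - 2) / 2)
    (hfree : (SimpleGraph.pathGraph t).Free G) :
    (n < t →
      -√(((n / 2 : ℕ) : ℝ) * (((n + 1) / 2 : ℕ) : ℝ)) ≤ G.leastEigenvalue ∧
      (G.leastEigenvalue = -√(((n / 2 : ℕ) : ℝ) * (((n + 1) / 2 : ℕ) : ℝ)) ↔
        Nonempty (G ≃g completeBipartiteGraph (Fin (n / 2)) (Fin ((n + 1) / 2))))) ∧
    (t ≤ n → t ≠ 3 →
      -√((k : ℝ) * ((n : ℝ) - (k : ℝ))) ≤ G.leastEigenvalue ∧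
      (G.leastEigenvalue = -√((k : ℝ) * ((n : ℝ) - (k : ℝ))) ↔
        Nonempty (G ≃g completeBipartiteGraph (Fin k) (Fin (n - k))) ∨
        (n = 5 ∧ t = 5 ∧
          Nonempty (G ≃g (completeBipartiteGraph (Fin 2) (Fin 2) ⊕g
            (⊤ : SimpleGraph (Fin 1))))))) := by
  refine ⟨fun _ ↦ ?_, fun ht ht3 ↦ ?_⟩
  · have hV : Fintype.card V = n / 2 + (n + 1) / 2 := by lia
    exact ⟨PathFree.neg_sqrt_le_leastEigenvalue_balanced hV (by lia) (by lia),
      PathFree.leastEigenvalue_eq_iff_balanced hV (by lia) (by lia)⟩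
  · obtain ⟨m, rfl⟩ : ∃ m, n = k + m := Nat.exists_eq_add_of_le (by lia)
    rw [Nat.cast_add, add_sub_cancel_left, Nat.add_sub_cancel_left]
    exact ⟨PathFree.neg_sqrt_le_leastEigenvalue_of_free hn hk ht ht3 hfree,
      PathFree.leastEigenvalue_eq_iff_of_free hn hk ht ht3 hfree⟩
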